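/- Let $M\in\mathbb N$, let $\rho\in(1,\infty)^M$, let $X$ be a complex Hilbert space, and let $v:B_{\mathbb C}(0,\rho)\to X$ be holomorphic on the open polydisc $B_{\mathbb C}(0,\rho)=\prod_{i=1}^M\{z\in\mathbb C:|z|<\rho_i\}$ with $\|v\|_{L^\infty(B_{\mathbb C}(0,\rho);X)}<\infty$. Let $\mu$ be the uniform probability measure on $[-1,1]^M$. For $k\in\mathbb N=\{0,1,2,\dots\}$ let $L_k=\sqrt{2k+1}\,P_k$, where $P_k$ is the Legendre polynomial with $P_k(1)=1$, and for $m\in\mathbb N^M$ let $L_m(y)=\prod_{i=1}^M L_{m_i}(y_i)$. The Legendre coefficients of $v$ are $\hat v_m=\int v(y)L_m(y)\,d\mu(y)\in X$, $m\in\mathbb N^M$. For $p\in(0,\infty]$ and a weight $w\in[0,\infty]^{\mathbb N^M}$ put $\|x\|_{\ell^p_w\otimes X}=\big\|(w_m\|x_m\|_X)_{m\in\mathbb N^M}\big\|_{\ell^p}\in[0,\infty]$; $x\in\ell^p_w\otimes X$ means that this is finite, and $\ell^p$ without a weight means $w\equiv1$. Write $\|a\|_\bullet=\prod_{i=1}^M|a_i|$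 for $a\in\mathbb R^M$, $\rho^m=\prod_i\rho_i^{m_i}$, and $\bar\omega_m=\|2m+1\|_\bullet^{-1/2}\rho^m$. Operations on vectors and sequences are understood element-wise, and $0\cdot\infty=0$. (i) For every $p\in(0,\infty]$ and every $\tilde\omega\in(0,\infty)^{\mathbb N^M}$, $$\|\hat v\|_{\ell^p_{\tilde\omega}\otimes X}\le\Big\|\frac{\rho^2}{\rho^2-1}\Big\|_\bullet\,\Big\|\frac{\tilde\omega}{\bar\omega}\Big\|_{\ell^p}\,\|v\|_{L^\infty(B_{\mathbb C}(0,\rho);X)},$$ where the norms take values in $[0,\infty]$, so the bound is meaningful also when $\|\tilde\omega/\bar\omega\|_{\ell^p}=\infty$. (ii) $\hat v\in\ell^2\otimes X$. (iii) For every $p\in(0,\infty)$ and every weight sequence $\omega\in[0,\infty]^{\mathbb N^M}$ with $\omega^{(2-p)/p}/\bar\omega\in\ell^p$ or $\omega^{(2-p)/p}/\bar\omega\in\ell^1$, one has $\hat v\in\ell^p_{\omega^{(2-p)/p}}\otimes X$. -/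

import Mathlib

open MeasureTheory
open scoped ENNReal

noncomputable section

/-- The classical Legendre polynomial of degree `k` (Rodrigues' formula), with value `1` at `1`. -/
def legendreP (k : ℕ) : Polynomial ℝ :=
  Polynomial.C ((2 ^ k * (k.factorial : ℝ))⁻¹) *
    Polynomial.derivative^[k] ((Polynomial.X ^ 2 - 1) ^ k)

/-- The uniform probability measure on `[-1, 1]`. -/
def unifMeasure : Measure ℝ :=
  ProbabilityTheory.cond volume (Set.Icc (-1 : ℝ) 1)

/-- The Legendre polynomial normalized in `L²` of the uniform probability measure on `[-1, 1]`. -/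
def legendreL (k : ℕ) (t : ℝ) : ℝ :=
  √(2 * (k : ℝ) + 1) * (legendreP k).eval t

/-- The tensor product Legendre polynomial of multi-index `m`. -/
def legendreTensor {M : ℕ} (m : Fin M → ℕ) (y : Fin M → ℝ) : ℝ :=
  ∏ i, legendreL (m i) (y i)

/-- The open polydisc in `ℂ^M` with centre `0` and polyradius `ρ`. -/
def polydisc {M : ℕ} (ρ : Fin M → ℝ) : Set (Fin M → ℂ) :=
  Set.univ.pi fun i => Metric.ball (0 : ℂ) (ρ i)

/-- The Legendre coefficient `∫ v(y) L_m(y) dμ(y)`, where `μ` is the product over the `M`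
coordinates of the uniform probability measures on `[-1, 1]`. -/
def legendreCoeff {M : ℕ} {X : Type*} [NormedAddCommGroup X] [InnerProductSpace ℂ X]
    (v : (Fin M → ℂ) → X) (m : Fin M → ℕ) : X :=
  ∫ y : Fin M → ℝ, ((legendreTensor m y : ℝ) : ℂ) • v (fun i => (y i : ℂ))
    ∂(Measure.pi fun _ : Fin M => unifMeasure)

/-- `‖x‖_• = ∏ |x_i|`. -/
def bulletNorm {M : ℕ} (x : Fin M → ℝ) : ℝ := ∏ i, |x i|

/-- The weight `‖2m + 1‖_•^{-1/2} ρ^m`. -/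
def omegaBar {M : ℕ} (ρ : Fin M → ℝ) (m : Fin M → ℕ) : ℝ :=
  (bulletNorm fun i => 2 * (m i : ℝ) + 1) ^ (-(1 / 2) : ℝ) * ∏ i, ρ i ^ m i

/-- The `ℓ^p` (quasi-)norm of a `[0, ∞]`-valued family indexed by multi-indices, as an element
of `[0, ∞]`. -/
def ellNorm {M : ℕ} (p : ℝ≥0∞) (a : (Fin M → ℕ) → ℝ≥0∞) : ℝ≥0∞ :=
  eLpNorm a p Measure.count

/-- The weighted `ℓ^p_w ⊗ X` (quasi-)norm of an `X`-valued family, i.e. the `ℓ^p` norm of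
`m ↦ w_m ‖x_m‖`. -/
def weightedEllNorm {M : ℕ} {X : Type*} [NormedAddCommGroup X] (p : ℝ≥0∞)
    (w : (Fin M → ℕ) → ℝ≥0∞) (x : (Fin M → ℕ) → X) : ℝ≥0∞ :=
  ellNorm p fun m => w m * ‖x m‖ₑ

end

/-!
The Legendre coefficients of `v` decay slightly faster than the weights `1 / ω̄` require, and this
single fact yields all three claims.

In one variable, Cauchy's formula on a circle of radius `r > 1` turns the coefficient of degree `k`
into the circle integral of `v` against the kernel `K_k(z) = ∫ L_k(y) (z - y)⁻¹ dμ(y)`. By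
Rodrigues' formula and `k` integrations by parts, `K_k(z)` is up to sign
`√(2k + 1) ∫ ((1 - y²) / (2 (z - y)))^k (z - y)⁻¹ dμ(y)`. The base of the power is at most `θ / r`
in modulus with `θ = (1 + r⁻²) / 2 < 1`, and `∫ |z - y|⁻¹ dμ(y) ≤ r / (r² - 1)` after averaging over
`± y`. This is `norm_legendreKernel_le`.

In several variables, `norm_legendreCoeff_le` proceeds by induction on the number of variables:
Cauchy's formula is applied in the first variable only, and Fubini's theorem writes the coefficient
of `v` as a circle integral of the kernel times coefficients of the slices `v(z, ·)`, which are
again holomorphic and bounded. Letting the radius tend to `ρ 0` gives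
`‖v̂_m‖ ≤ ‖ρ² / (ρ² - 1)‖_• θ^m ‖v‖_∞ / ω̄_m`.

Claim (i) discards `θ^m`. For (ii) and (iii), the family `θ^m` lies in every `ℓ^p` with
`0 < p < ∞`, so the weight only has to be bounded by a multiple of `ω̄`; membership in `ℓ^p` or `ℓ¹`
gives that. For `p < 1` and the `ℓ¹` hypothesis the gain `θ^m` is essential, because then `ℓ¹` is
not contained in `ℓ^p`.
-/

/-! ### The one-variable Legendre kernel -/

lemma integral_unifMeasure {E : Type*} [NormedAddCommGroup E] [NormedSpace ℝ E] (f : ℝ → E) :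
    ∫ y, f y ∂unifMeasure = (2 : ℝ)⁻¹ • ∫ y in (-1 : ℝ)..1, f y := by
  have h : unifMeasure = ENNReal.ofReal 2⁻¹ • volume.restrict (Set.Icc (-1 : ℝ) 1) := by
    rw [unifMeasure, ProbabilityTheory.cond, Real.volume_Icc,
      ENNReal.ofReal_inv_of_pos (by norm_num)]
    norm_num
  rw [h, integral_smul_measure, intervalIntegral.integral_of_le (by norm_num),
    integral_Icc_eq_integral_Ioc, ENNReal.toReal_ofReal (by norm_num)]

instance instIsProbabilityMeasureUnifMeasure : IsProbabilityMeasure unifMeasure :=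
  ProbabilityTheory.cond_isProbabilityMeasure_of_finite (by simp) (by simp)

lemma ae_unifMeasure_mem_Icc : ∀ᵐ y ∂unifMeasure, y ∈ Set.Icc (-1 : ℝ) 1 :=
  ProbabilityTheory.ae_cond_mem measurableSet_Icc

/-- The factor `θ < 1` by which the decay of the Legendre coefficients of a function bounded on
the disc of radius `r` beats `r⁻¹`. -/
noncomputable def decayFactor (r : ℝ) : ℝ := (1 + (r ^ 2)⁻¹) / 2

lemma decayFactor_pos (r : ℝ) : 0 < decayFactor r := by
  unfold decayFactor; positivity

lemma decayFactor_lt_one {r : ℝ} (hr : 1 < r) : decayFactor r < 1 := by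
  have := inv_lt_one_of_one_lt₀ (one_lt_pow₀ hr two_ne_zero)
  unfold decayFactor; linarith

lemma sub_ofReal_ne_zero {z : ℂ} (hz : 1 < ‖z‖) {y : ℝ} (hy : y ∈ Set.Icc (-1 : ℝ) 1) :
    z - (y : ℂ) ≠ 0 := by
  rintro h
  rw [sub_eq_zero] at h
  rw [h, Complex.norm_real, Real.norm_eq_abs] at hz
  exact absurd (abs_le.2 hy) (not_le.2 hz)

/-- The quotient `(1 - y²) / (2 |z - y|)`, of which a power appears after integrating by parts, is
smaller than `|z|⁻¹` by a factor bounded away from `1`. -/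
lemma one_sub_sq_le_decayFactor {z : ℂ} (hz : 1 < ‖z‖) {y : ℝ} (hy : y ∈ Set.Icc (-1 : ℝ) 1) :
    (1 - y ^ 2) / (2 * ‖z - (y : ℂ)‖) ≤ decayFactor ‖z‖ / ‖z‖ := by
  have hy' := abs_le.2 hy
  have hpos : 0 < ‖z - (y : ℂ)‖ := norm_pos_iff.2 (sub_ofReal_ne_zero hz hy)
  have htri : ‖z‖ - |y| ≤ ‖z - (y : ℂ)‖ := by
    simpa [Complex.norm_real] using norm_sub_norm_le z (y : ℂ)
  set r := ‖z‖
  have h0 := abs_nonneg y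
  have hsq : y ^ 2 = |y| ^ 2 := (sq_abs y).symm
  set s := |y|
  have hr : r ≠ 0 := by positivity
  rw [div_le_div_iff₀ (by positivity) (by positivity), hsq]
  have key : (1 - s ^ 2) * r ≤ decayFactor r * (2 * (r - s)) := by
    have e : decayFactor r * (2 * (r - s)) - (1 - s ^ 2) * r
        = r * (s - r⁻¹) ^ 2 + s * (1 - (r ^ 2)⁻¹) := by
      unfold decayFactor; field_simp; ring
    have : (r ^ 2)⁻¹ ≤ 1 := inv_le_one_of_one_le₀ (by nlinarith)
    have : 0 ≤ r * (s - r⁻¹) ^ 2 + s * (1 - (r ^ 2)⁻¹) := by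
      have : 0 ≤ s * (1 - (r ^ 2)⁻¹) := mul_nonneg h0 (by linarith)
      positivity
    linarith
  have := mul_le_mul_of_nonneg_left htri (decayFactor_pos r).le
  linarith

/-- Averaging over `± y` removes the dependence on the argument of `z`. -/
lemma inv_norm_sub_add_inv_norm_add_le {z : ℂ} (hz : 1 < ‖z‖) {y : ℝ}
    (hy : y ∈ Set.Icc (-1 : ℝ) 1) :
    ‖z - (y : ℂ)‖⁻¹ + ‖z + (y : ℂ)‖⁻¹ ≤ 2 * (‖z‖ / (‖z‖ ^ 2 - 1)) := by
  have ha : 0 < ‖z - (y : ℂ)‖ := norm_pos_iff.2 (sub_ofReal_ne_zero hz hy)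
  have hb : 0 < ‖z + (y : ℂ)‖ := by
    have := sub_ofReal_ne_zero hz (y := -y) ⟨by linarith [hy.2], by linarith [hy.1]⟩
    rw [norm_pos_iff]
    simpa using this
  have hpar : ‖z - (y : ℂ)‖ ^ 2 + ‖z + (y : ℂ)‖ ^ 2 = 2 * (‖z‖ ^ 2 + y ^ 2) := by
    have := parallelogram_law_with_norm ℝ z (y : ℂ)
    simp only [Complex.norm_real, Real.norm_eq_abs] at this
    linarith [sq_abs y]
  have htri : 2 * ‖z‖ ≤ ‖z - (y : ℂ)‖ + ‖z + (y : ℂ)‖ := by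
    have := norm_add_le (z - (y : ℂ)) (z + (y : ℂ))
    have e : z - (y : ℂ) + (z + y) = 2 * z := by ring
    rw [e, norm_mul] at this
    simpa using this
  set a := ‖z - (y : ℂ)‖
  set b := ‖z + (y : ℂ)‖
  set r := ‖z‖
  have hy2 : y ^ 2 ≤ 1 := by nlinarith [hy.1, hy.2]
  have hr : 0 < r ^ 2 - 1 := by nlinarith
  -- with `S = a + b` the product `a b` is `S² / 2 - (r² + y²)`, so `S / (a b)` decreases in `S`
  have hab : a * b = (a + b) ^ 2 / 2 - (r ^ 2 + y ^ 2) := by linarith [add_sq a b]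
  rw [inv_add_inv ha.ne' hb.ne', ← mul_div_assoc, div_le_div_iff₀ (by positivity) hr, hab]
  set S := a + b
  nlinarith [mul_nonneg (sub_nonneg.2 htri) (by positivity : 0 ≤ r * S),
    mul_nonneg (sub_nonneg.2 htri) (by positivity : 0 ≤ r ^ 2 + 1),
    mul_nonneg (by positivity : 0 ≤ r) (sub_nonneg.2 hy2)]

lemma intervalIntegrable_mul_inv_pow {z : ℂ} (hz : 1 < ‖z‖) {f : ℝ → ℂ} (hf : Continuous f)
    (n : ℕ) : IntervalIntegrable (fun y : ℝ => f y * ((z - (y : ℂ)) ^ n)⁻¹) volume (-1) 1 := by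
  apply ContinuousOn.intervalIntegrable
  rw [Set.uIcc_of_le (by norm_num)]
  refine hf.continuousOn.mul (ContinuousOn.inv₀ (by fun_prop) fun y hy => ?_)
  exact pow_ne_zero _ (sub_ofReal_ne_zero hz hy)

lemma integral_inv_norm_sub_le {z : ℂ} (hz : 1 < ‖z‖) :
    ∫ y in (-1 : ℝ)..1, ‖z - (y : ℂ)‖⁻¹ ≤ 2 * (‖z‖ / (‖z‖ ^ 2 - 1)) := by
  have hi : ∀ w : ℂ, 1 < ‖w‖ →
      IntervalIntegrable (fun y : ℝ => ‖w - (y : ℂ)‖⁻¹) volume (-1) 1 := fun w hw => by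
    simpa using (intervalIntegrable_mul_inv_pow hw (f := fun _ => 1) continuous_const 1).norm
  have hi' : IntervalIntegrable (fun y : ℝ => ‖z + (y : ℂ)‖⁻¹) volume (-1) 1 := by
    have := hi (-z) (by simpa using hz)
    refine this.congr fun y _ => ?_
    rw [← norm_neg]; congr 2; ring
  have hsym : ∫ y in (-1 : ℝ)..1, ‖z + (y : ℂ)‖⁻¹ = ∫ y in (-1 : ℝ)..1, ‖z - (y : ℂ)‖⁻¹ := by
    have := intervalIntegral.integral_comp_neg (a := -1) (b := 1)
      (fun y : ℝ => ‖z - (y : ℂ)‖⁻¹)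
    simpa using this
  have hle : ∫ y in (-1 : ℝ)..1, (‖z - (y : ℂ)‖⁻¹ + ‖z + (y : ℂ)‖⁻¹)
      ≤ ∫ y in (-1 : ℝ)..1, 2 * (‖z‖ / (‖z‖ ^ 2 - 1)) :=
    intervalIntegral.integral_mono_on (by norm_num) ((hi z hz).add hi')
      intervalIntegrable_const fun y hy => inv_norm_sub_add_inv_norm_add_le hz hy
  rw [intervalIntegral.integral_add (hi z hz) hi', hsym, intervalIntegral.integral_const,
    smul_eq_mul] at hle
  linarith

open Polynomial in
/-- Repeated integration by parts against the Cauchy kernel. All boundary terms vanish, because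
`± 1` are zeros of order `k` of `(X² - 1)^k`. -/
lemma integral_iterate_derivative_mul_inv {z : ℂ} (hz : 1 < ‖z‖) (k n : ℕ) (hn : n ≤ k) :
    ∫ y in (-1 : ℝ)..1,
        (((derivative^[k] ((X ^ 2 - 1 : ℝ[X]) ^ k)).eval y : ℝ) : ℂ) * ((z - (y : ℂ)) ^ 1)⁻¹ =
      (-1) ^ n * (n.factorial : ℂ) * ∫ y in (-1 : ℝ)..1,
        (((derivative^[k - n] ((X ^ 2 - 1 : ℝ[X]) ^ k)).eval y : ℝ) : ℂ) *
          ((z - (y : ℂ)) ^ (n + 1))⁻¹ := by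
  induction n with
  | zero => simp
  | succ n ih =>
    rw [ih (by omega)]
    obtain ⟨j, hj⟩ : ∃ j, k - n = j + 1 := ⟨k - n - 1, by omega⟩
    have hj' : k - (n + 1) = j := by omega
    rw [hj, hj', Function.iterate_succ_apply']
    set q := derivative^[j] ((X ^ 2 - 1 : ℝ[X]) ^ k) with hq
    have hz0 : ∀ y : ℝ, y ^ 2 = 1 → q.eval y = 0 := fun y hy => by
      obtain ⟨c, hc⟩ := pow_sub_dvd_iterate_derivative_pow (X ^ 2 - 1 : ℝ[X]) k j
      rw [hq, hc, eval_mul, eval_pow]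
      simp [hy, show k - j ≠ 0 by omega]
    have hu : ∀ y ∈ Set.uIcc (-1 : ℝ) 1,
        HasDerivAt (fun y : ℝ => ((z - (y : ℂ)) ^ (n + 1))⁻¹)
          ((n + 1 : ℂ) * ((z - (y : ℂ)) ^ (n + 2))⁻¹) y := fun y hy => by
      rw [Set.uIcc_of_le (by norm_num)] at hy
      have hne := sub_ofReal_ne_zero hz hy
      have h1 : HasDerivAt (fun y : ℝ => z - (y : ℂ)) (-1) y :=
        (Complex.ofRealCLM.hasDerivAt (x := y)).const_sub z
      refine ((h1.fun_pow (n + 1)).fun_inv (pow_ne_zero _ hne)).congr_deriv ?_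
      rw [Nat.add_sub_cancel]
      push_cast
      field_simp
      ring
    have hv : ∀ y ∈ Set.uIcc (-1 : ℝ) 1, HasDerivAt (fun y : ℝ => ((q.eval y : ℝ) : ℂ))
        (((derivative q).eval y : ℝ) : ℂ) y := fun y _ => (q.hasDerivAt y).ofReal_comp
    have hparts := intervalIntegral.integral_mul_deriv_eq_deriv_mul hu hv
      (by simpa using (intervalIntegrable_mul_inv_pow hz (f := fun _ => (n + 1 : ℂ))
        continuous_const (n + 2)))
      (Continuous.intervalIntegrable (by fun_prop) _ _)
    rw [hz0 1 (by norm_num), hz0 (-1) (by norm_num)] at hparts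
    have e1 : ∫ y in (-1 : ℝ)..1, (((derivative q).eval y : ℝ) : ℂ) *
        ((z - (y : ℂ)) ^ (n + 1))⁻¹ = ∫ y in (-1 : ℝ)..1, ((z - (y : ℂ)) ^ (n + 1))⁻¹ *
          (((derivative q).eval y : ℝ) : ℂ) := by
      simp_rw [mul_comm]
    have e2 : ∫ y in (-1 : ℝ)..1, (n + 1 : ℂ) * ((z - (y : ℂ)) ^ (n + 2))⁻¹ * (q.eval y : ℝ) =
        (n + 1 : ℂ) * ∫ y in (-1 : ℝ)..1, ((q.eval y : ℝ) : ℂ) *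
          ((z - (y : ℂ)) ^ (n + 1 + 1))⁻¹ := by
      rw [← intervalIntegral.integral_const_mul]
      congr 1; ext y; ring
    rw [e1, hparts, e2, Nat.factorial_succ]
    push_cast
    ring

/-- The integral of the Cauchy kernel `(z - y)⁻¹` against `L_k`. -/
noncomputable def legendreKernel (k : ℕ) (z : ℂ) : ℂ :=
  ∫ y, ((legendreL k y : ℝ) : ℂ) * (z - (y : ℂ))⁻¹ ∂unifMeasure

/-- The one-variable estimate: by Rodrigues' formula and `k` integrations by parts, the kernel is
up to sign `√(2k + 1) ∫ ((1 - y²) / (2 (z - y)))^k (z - y)⁻¹ dμ(y)`. -/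
lemma norm_legendreKernel_le (k : ℕ) {z : ℂ} (hz : 1 < ‖z‖) :
    ‖legendreKernel k z‖ ≤
      √(2 * (k : ℝ) + 1) * (decayFactor ‖z‖ / ‖z‖) ^ k * (‖z‖ / (‖z‖ ^ 2 - 1)) := by
  have hform : legendreKernel k z = (2 : ℝ)⁻¹ • ((√(2 * (k : ℝ) + 1) : ℂ) * (2 ^ k)⁻¹ * (-1) ^ k *
      ∫ y in (-1 : ℝ)..1, (((y ^ 2 - 1) ^ k : ℝ) : ℂ) * ((z - (y : ℂ)) ^ (k + 1))⁻¹) := by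
    have h := integral_iterate_derivative_mul_inv hz k k le_rfl
    simp only [Nat.sub_self, Function.iterate_zero, id, Polynomial.eval_pow, Polynomial.eval_sub,
      Polynomial.eval_X, Polynomial.eval_one, pow_one] at h
    have hk : (k.factorial : ℂ) ≠ 0 := by exact_mod_cast k.factorial_ne_zero
    rw [legendreKernel, integral_unifMeasure]
    congr 1
    have e : ∀ y : ℝ, ((legendreL k y : ℝ) : ℂ) * (z - (y : ℂ))⁻¹ =
        ((√(2 * (k : ℝ) + 1) : ℂ) * (2 ^ k * (k.factorial : ℂ))⁻¹) *
        ((((Polynomial.derivative^[k] ((Polynomial.X ^ 2 - 1 : Polynomial ℝ) ^ k)).eval y : ℝ) : ℂ)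
          * (z - (y : ℂ))⁻¹) := fun y => by
      simp only [legendreL, legendreP, Polynomial.eval_mul, Polynomial.eval_C]
      push_cast
      ring
    simp_rw [e]
    rw [intervalIntegral.integral_const_mul, h]
    field_simp
  have hint : ‖∫ y in (-1 : ℝ)..1, (((y ^ 2 - 1) ^ k : ℝ) : ℂ) * ((z - (y : ℂ)) ^ (k + 1))⁻¹‖ ≤
      2 ^ k * (decayFactor ‖z‖ / ‖z‖) ^ k * (2 * (‖z‖ / (‖z‖ ^ 2 - 1))) := by
    have hi : IntervalIntegrable (fun y : ℝ => ‖z - (y : ℂ)‖⁻¹) volume (-1) 1 := by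
      simpa using (intervalIntegrable_mul_inv_pow hz (f := fun _ => 1) continuous_const 1).norm
    refine (intervalIntegral.norm_integral_le_of_norm_le (g := fun y : ℝ =>
      2 ^ k * (decayFactor ‖z‖ / ‖z‖) ^ k * ‖z - (y : ℂ)‖⁻¹) (by norm_num)
      (ae_of_all _ fun y hy => ?_) (hi.const_mul _)).trans ?_
    · have hy' : y ∈ Set.Icc (-1 : ℝ) 1 := Set.Ioc_subset_Icc_self hy
      have hy2 : 0 ≤ 1 - y ^ 2 := by nlinarith [hy'.1, hy'.2]
      have hpos : 0 < ‖z - (y : ℂ)‖ := norm_pos_iff.2 (sub_ofReal_ne_zero hz hy')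
      have hb := one_sub_sq_le_decayFactor hz hy'
      have : ‖(((y ^ 2 - 1) ^ k : ℝ) : ℂ) * ((z - (y : ℂ)) ^ (k + 1))⁻¹‖ =
          2 ^ k * ((1 - y ^ 2) / (2 * ‖z - (y : ℂ)‖)) ^ k * ‖z - (y : ℂ)‖⁻¹ := by
        rw [norm_mul, Complex.norm_real, norm_pow, Real.norm_eq_abs, abs_sub_comm,
          abs_of_nonneg hy2, norm_inv, norm_pow, div_pow, mul_pow]
        field_simp
        ring
      rw [this]
      gcongr
    · rw [intervalIntegral.integral_const_mul]
      have := decayFactor_pos ‖z‖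
      gcongr
      exact integral_inv_norm_sub_le hz
  rw [hform, norm_smul, norm_mul, norm_mul, norm_mul, norm_pow, norm_neg, norm_one, one_pow,
    mul_one, Complex.norm_real, Real.norm_of_nonneg (Real.sqrt_nonneg _), norm_inv, norm_inv, norm_pow,
    Complex.norm_ofNat, Real.norm_ofNat]
  calc _ ≤ (2 : ℝ)⁻¹ * (√(2 * (k : ℝ) + 1) * (2 ^ k)⁻¹ *
        (2 ^ k * (decayFactor ‖z‖ / ‖z‖) ^ k * (2 * (‖z‖ / (‖z‖ ^ 2 - 1))))) := by gcongr
    _ = _ := by field_simp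

/-! ### Legendre coefficients on polydiscs -/

/-- Fubini for a circle integral and a finite measure concentrated on a compact set. -/
lemma integral_circleIntegral_swap {Y X : Type*} [MetricSpace Y] [SecondCountableTopology Y]
    [MeasurableSpace Y] [BorelSpace Y] [NormedAddCommGroup X] [NormedSpace ℂ X]
    {ν : Measure Y} [IsFiniteMeasure ν] {K : Set Y} (hK : IsCompact K) (hν : ∀ᵐ y ∂ν, y ∈ K)
    {R : ℝ} (hR : 0 ≤ R) {F : Y → ℂ → X}
    (hF : ContinuousOn (Function.uncurry F) (K ×ˢ Metric.sphere 0 R)) :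
    ∫ y, (∮ z in C(0, R), F y z) ∂ν = ∮ z in C(0, R), ∫ y, F y z ∂ν := by
  have h2π : (0 : ℝ) ≤ 2 * Real.pi := Real.two_pi_pos.le
  simp only [circleIntegral, intervalIntegral.integral_of_le h2π]
  rw [integral_integral_swap]
  · refine integral_congr_ae (ae_of_all _ fun θ => ?_)
    exact integral_smul (deriv (circleMap 0 R) θ) fun y => F y (circleMap 0 R θ)
  · have hrestr : ν.restrict K = ν := Measure.restrict_eq_self_of_ae_mem hν
    rw [← hrestr, Measure.prod_restrict]
    refine IntegrableOn.mono_set (t := K ×ˢ Set.Icc 0 (2 * Real.pi)) ?_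
      (Set.prod_mono le_rfl Set.Ioc_subset_Icc_self)
    refine ContinuousOn.integrableOn_compact (hK.prod isCompact_Icc) ?_
    have hc : Continuous fun θ : ℝ => circleMap 0 R θ := continuous_circleMap 0 R
    simp only [deriv_circleMap]
    refine ContinuousOn.smul (by fun_prop) ?_
    refine hF.comp (f := fun p : Y × ℝ => (p.1, circleMap 0 R p.2)) (by fun_prop) ?_
    exact fun p hp => ⟨hp.1, circleMap_mem_sphere _ hR _⟩

/-- The cube `[-1, 1]^M`. -/
def cube (M : ℕ) : Set (Fin M → ℝ) := Set.univ.pi fun _ => Set.Icc (-1) 1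

lemma isCompact_cube (M : ℕ) : IsCompact (cube M) := isCompact_univ_pi fun _ => isCompact_Icc

lemma ae_mem_cube (M : ℕ) :
    ∀ᵐ y ∂(Measure.pi fun _ : Fin M => unifMeasure), y ∈ cube M := by
  have h : ∀ i : Fin M, ∀ᵐ y ∂(Measure.pi fun _ : Fin M => unifMeasure),
      y i ∈ Set.Icc (-1 : ℝ) 1 := fun i =>
    (Measure.quasiMeasurePreserving_eval (μ := fun _ : Fin M => unifMeasure) i).ae
      ae_unifMeasure_mem_Icc
  filter_upwards [ae_all_iff.2 h] with y hy i _ using hy i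

lemma continuous_legendreTensor {M : ℕ} (m : Fin M → ℕ) : Continuous (legendreTensor m) := by
  unfold legendreTensor legendreL
  fun_prop

/-- A product integrand over `M + 1` coordinates separates into the Legendre kernel in the first
variable and a Legendre coefficient in the others. -/
lemma integral_legendreTensor_cauchyKernel {M : ℕ} {X : Type*} [NormedAddCommGroup X]
    [InnerProductSpace ℂ X] (u : (Fin M → ℂ) → X) (m : Fin (M + 1) → ℕ) (z : ℂ) :
    ∫ y : Fin (M + 1) → ℝ, ((legendreTensor m y : ℝ) : ℂ) • (z - (y 0 : ℂ))⁻¹ •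
        u (fun i => (y i.succ : ℂ)) ∂(Measure.pi fun _ : Fin (M + 1) => unifMeasure) =
      legendreKernel (m 0) z • legendreCoeff u (fun i => m i.succ) := by
  have hmp := measurePreserving_piFinSuccAbove (fun _ : Fin (M + 1) => unifMeasure) 0
  unfold legendreKernel legendreCoeff
  rw [← integral_prod_smul, ← hmp.integral_comp (MeasurableEquiv.measurableEmbedding _)]
  refine integral_congr_ae (ae_of_all _ fun y => ?_)
  simp only [legendreTensor, Fin.prod_univ_succ, MeasurableEquiv.piFinSuccAbove_apply,
    Fin.insertNthEquiv_zero, Fin.consEquiv_symm_apply, Fin.tail]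
  push_cast
  simp only [smul_smul]
  congr 1
  ring

lemma finCons_mem_polydisc {M : ℕ} {ρ : Fin (M + 1) → ℝ} {z : ℂ} {w : Fin M → ℂ}
    (hz : z ∈ Metric.ball (0 : ℂ) (ρ 0)) (hw : w ∈ polydisc fun i => ρ i.succ) :
    (Fin.cons z w : Fin (M + 1) → ℂ) ∈ polydisc ρ := by
  intro i _
  refine Fin.cases ?_ (fun j => ?_) i
  · simpa using hz
  · simpa using hw j trivial

lemma ofReal_mem_ball {y r : ℝ} (hr : 1 < r) (hy : y ∈ Set.Icc (-1 : ℝ) 1) :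
    (y : ℂ) ∈ Metric.ball (0 : ℂ) r := by
  simpa using (abs_le.2 hy).trans_lt hr

lemma ofReal_mem_polydisc {M : ℕ} {ρ : Fin M → ℝ} (hρ : ∀ i, 1 < ρ i) {y : Fin M → ℝ}
    (hy : ∀ i, y i ∈ Set.Icc (-1 : ℝ) 1) : (fun i => (y i : ℂ)) ∈ polydisc ρ :=
  fun i _ => ofReal_mem_ball (hρ i) (hy i)

/-- Cauchy's formula in the first variable alone expresses the Legendre coefficients through those
of the slices of `v`. -/
lemma legendreCoeff_eq_circleIntegral {M : ℕ} {X : Type*} [NormedAddCommGroup X]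
    [InnerProductSpace ℂ X] [CompleteSpace X] {ρ : Fin (M + 1) → ℝ} (hρ : ∀ i, 1 < ρ i)
    {v : (Fin (M + 1) → ℂ) → X} (hv : DifferentiableOn ℂ v (polydisc ρ)) (m : Fin (M + 1) → ℕ)
    {R : ℝ} (hR : 1 < R) (hRρ : R < ρ 0) :
    legendreCoeff v m = (2 * Real.pi * Complex.I : ℂ)⁻¹ • ∮ z in C(0, R),
      legendreKernel (m 0) z • legendreCoeff (fun w => v (Fin.cons z w)) (fun i => m i.succ) := by
  have hsub : Metric.closedBall (0 : ℂ) R ⊆ Metric.ball 0 (ρ 0) :=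
    Metric.closedBall_subset_ball hRρ
  have hcauchy : ∀ y ∈ cube (M + 1), ((legendreTensor m y : ℝ) : ℂ) • v (fun i => (y i : ℂ)) =
      (2 * Real.pi * Complex.I : ℂ)⁻¹ • ∮ z in C(0, R), ((legendreTensor m y : ℝ) : ℂ) •
        (z - (y 0 : ℂ))⁻¹ • v (Fin.cons z fun i => (y i.succ : ℂ)) := fun y hy => by
    have hmaps : Set.MapsTo (fun z : ℂ => (Fin.cons z fun i => (y i.succ : ℂ) :
        Fin (M + 1) → ℂ)) (Metric.closedBall 0 R) (polydisc ρ) := fun z hz =>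
      finCons_mem_polydisc (hsub hz)
        (ofReal_mem_polydisc (fun i => hρ i.succ) fun i => hy i.succ trivial)
    have hd := hv.comp (differentiable_finCons.2
      ⟨differentiable_id, differentiable_const _⟩).differentiableOn hmaps
    have h := hd.circleIntegral_sub_inv_smul (ofReal_mem_ball hR (hy 0 trivial))
    have hy0 : (Fin.cons (y 0 : ℂ) fun i => (y i.succ : ℂ) : Fin (M + 1) → ℂ) =
        fun i => (y i : ℂ) := by
      ext i; refine Fin.cases ?_ (fun j => ?_) i <;> simp
    simp only [Function.comp_apply, id, hy0] at h
    rw [circleIntegral.integral_smul, h, smul_comm, inv_smul_smul₀ Complex.two_pi_I_ne_zero]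
  rw [legendreCoeff, integral_congr_ae ((ae_mem_cube (M + 1)).mono hcauchy), integral_smul,
    integral_circleIntegral_swap (isCompact_cube (M + 1)) (ae_mem_cube (M + 1)) (by linarith)]
  · have h z := integral_legendreTensor_cauchyKernel (fun w => v (Fin.cons z w)) m z
    simp_rw [h]
  · have hT : Continuous fun p : (Fin (M + 1) → ℝ) × ℂ => ((legendreTensor m p.1 : ℝ) : ℂ) :=
      Complex.continuous_ofReal.comp ((continuous_legendreTensor m).comp continuous_fst)
    refine hT.continuousOn.smul (ContinuousOn.smul (ContinuousOn.inv₀ (by fun_prop) ?_) ?_)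
    · rintro ⟨y, z⟩ ⟨hy, hz⟩
      exact sub_ofReal_ne_zero (by rw [mem_sphere_zero_iff_norm.1 hz]; exact hR)
        (hy 0 trivial)
    · refine hv.continuousOn.comp (f := fun p : (Fin (M + 1) → ℝ) × ℂ =>
        (Fin.cons p.2 fun i => (p.1 i.succ : ℂ) : Fin (M + 1) → ℂ)) ?_ ?_
      · refine Continuous.continuousOn (continuous_pi fun i => ?_)
        refine Fin.cases ?_ (fun j => ?_) i
        · simpa using continuous_snd
        · simp only [Fin.cons_succ]; fun_prop
      · rintro ⟨y, z⟩ ⟨hy, hz⟩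
        exact finCons_mem_polydisc (hsub (Metric.sphere_subset_closedBall hz))
          (ofReal_mem_polydisc (fun i => hρ i.succ) fun i => hy i.succ trivial)

/-- The contribution of one variable of radius `r` to the bound on a coefficient of degree `k`. -/
noncomputable def coeffBound (k : ℕ) (r : ℝ) : ℝ :=
  √(2 * (k : ℝ) + 1) * (decayFactor r / r) ^ k * (r ^ 2 / (r ^ 2 - 1))

/-- A function bounded by `C` on the polydisc has exponentially decaying Legendre coefficients. -/
theorem norm_legendreCoeff_le {X : Type*} [NormedAddCommGroup X] [InnerProductSpace ℂ X]
    [CompleteSpace X] {C : ℝ} {M : ℕ} (ρ : Fin M → ℝ) (hρ : ∀ i, 1 < ρ i)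
    (v : (Fin M → ℂ) → X) (hv : DifferentiableOn ℂ v (polydisc ρ))
    (hC : ∀ z ∈ polydisc ρ, ‖v z‖ ≤ C) (m : Fin M → ℕ) :
    ‖legendreCoeff v m‖ ≤ C * ∏ i, coeffBound (m i) (ρ i) := by
  induction M with
  | zero =>
    have hconst : ∀ z, v z = v 0 := fun z => by rw [Subsingleton.elim z 0]
    have : legendreCoeff v m = v 0 := by
      simp only [legendreCoeff, legendreTensor, hconst]
      simp
    rw [this]
    simpa using hC 0 fun i => i.elim0
  | succ M ih =>
    have hC0 : 0 ≤ C := (norm_nonneg _).trans (hC 0 fun i _ => by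
      simpa using zero_lt_one.trans (hρ i))
    set P := ∏ i : Fin M, coeffBound (m i.succ) (ρ i.succ) with hP
    have hR : ∀ R : ℝ, 1 < R → R < ρ 0 →
        ‖legendreCoeff v m‖ ≤ coeffBound (m 0) R * (C * P) := fun R h1 h2 => by
      rw [legendreCoeff_eq_circleIntegral hρ hv m h1 h2]
      refine (circleIntegral.norm_two_pi_i_inv_smul_integral_le_of_norm_le_const
        (C := √(2 * (m 0 : ℝ) + 1) * (decayFactor R / R) ^ (m 0) * (R / (R ^ 2 - 1)) * (C * P))
        (by linarith) fun z hz => ?_).trans (le_of_eq ?_)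
      · have hzn : ‖z‖ = R := mem_sphere_zero_iff_norm.1 hz
        have hzb : z ∈ Metric.ball (0 : ℂ) (ρ 0) := by simpa [hzn] using h2
        have hmaps : Set.MapsTo (fun w => (Fin.cons z w : Fin (M + 1) → ℂ))
            (polydisc fun i => ρ i.succ) (polydisc ρ) := fun w hw => finCons_mem_polydisc hzb hw
        have hk := norm_legendreKernel_le (m 0) (z := z) (by rwa [hzn])
        rw [hzn] at hk
        rw [norm_smul]
        exact mul_le_mul hk (ih (fun i => ρ i.succ) (fun i => hρ i.succ) _
          (hv.comp (differentiable_finCons.2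
            ⟨differentiable_const z, differentiable_id⟩).differentiableOn hmaps)
          (fun w hw => hC _ (hmaps hw)) fun i => m i.succ) (norm_nonneg _)
          ((norm_nonneg _).trans hk)
      · rw [coeffBound]; ring
    have h0 := hρ 0
    have hcont : ContinuousAt (fun R => coeffBound (m 0) R * (C * P)) (ρ 0) := by
      have : ρ 0 ≠ 0 := by linarith
      have : ρ 0 ^ 2 - 1 ≠ 0 := by nlinarith
      unfold coeffBound decayFactor
      fun_prop (disch := first | assumption | positivity)
    have hlim := hcont.tendsto.mono_left (nhdsWithin_le_nhds (s := Set.Iio (ρ 0)))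
    rw [Fin.prod_univ_succ, mul_left_comm]
    refine ge_of_tendsto hlim ?_
    filter_upwards [self_mem_nhdsWithin, nhdsWithin_le_nhds (Ioi_mem_nhds h0)] with R h2 h1
    exact hR R h1 h2

/-! ### Weights and sequence norms -/

lemma isOpen_polydisc {M : ℕ} (ρ : Fin M → ℝ) : IsOpen (polydisc ρ) :=
  isOpen_set_pi Set.finite_univ fun _ _ => Metric.isOpen_ball

lemma enorm_le_eLpNorm_top_restrict {M : ℕ} {X : Type*} [NormedAddCommGroup X]
    {U : Set (Fin M → ℂ)} (hU : IsOpen U) {v : (Fin M → ℂ) → X} (hv : ContinuousOn v U)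
    {z : Fin M → ℂ} (hz : z ∈ U) : ‖v z‖ₑ ≤ eLpNorm v ∞ (volume.restrict U) := by
  by_contra! hlt
  have hopen : IsOpen (U ∩ (fun z => ‖v z‖ₑ) ⁻¹' Set.Ioi (eLpNorm v ∞ (volume.restrict U))) :=
    hv.enorm.isOpen_inter_preimage hU isOpen_Ioi
  have hae : ∀ᵐ x ∂volume.restrict U, ‖v x‖ₑ ≤ eLpNorm v ∞ (volume.restrict U) := by
    rw [eLpNorm_exponent_top]
    exact ae_le_eLpNormEssSup
  have hnull : volume (U ∩ (fun z => ‖v z‖ₑ) ⁻¹'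
      Set.Ioi (eLpNorm v ∞ (volume.restrict U))) = 0 := by
    refine measure_mono_null ?_ (ae_iff.1 ((ae_restrict_iff' hU.measurableSet).1 hae))
    rintro x ⟨hx, hx'⟩ h
    exact absurd (h hx) (not_le.2 hx')
  exact Set.notMem_empty z ((hopen.eq_empty_of_measure_zero hnull) ▸ ⟨hz, hlt⟩)

lemma omegaBar_eq {M : ℕ} (ρ : Fin M → ℝ) (m : Fin M → ℕ) :
    omegaBar ρ m = ∏ i, ((√(2 * (m i : ℝ) + 1))⁻¹ * ρ i ^ m i) := by
  have h : ∀ i, (0 : ℝ) ≤ 2 * (m i : ℝ) + 1 := fun i => by positivity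
  rw [omegaBar, bulletNorm, ← Real.finsetProd_rpow _ _ fun i _ => abs_nonneg _,
    Finset.prod_mul_distrib]
  congr 1
  refine Finset.prod_congr rfl fun i _ => ?_
  rw [abs_of_nonneg (h i), Real.rpow_neg (h i), Real.sqrt_eq_rpow]

lemma omegaBar_pos {M : ℕ} {ρ : Fin M → ℝ} (hρ : ∀ i, 1 < ρ i) (m : Fin M → ℕ) :
    0 < omegaBar ρ m := by
  rw [omegaBar_eq]
  refine Finset.prod_pos fun i _ => ?_
  have := zero_lt_one.trans (hρ i)
  positivity

lemma prod_coeffBound {M : ℕ} {ρ : Fin M → ℝ} (hρ : ∀ i, 1 < ρ i) (m : Fin M → ℕ) :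
    ∏ i, coeffBound (m i) (ρ i) = (bulletNorm fun i => ρ i ^ 2 / (ρ i ^ 2 - 1)) *
      (∏ i, decayFactor (ρ i) ^ m i) / omegaBar ρ m := by
  rw [omegaBar_eq, bulletNorm, ← Finset.prod_mul_distrib, ← Finset.prod_div_distrib]
  refine Finset.prod_congr rfl fun i _ => ?_
  have h0 : 0 < ρ i := zero_lt_one.trans (hρ i)
  have h1 : 0 < ρ i ^ 2 - 1 := by nlinarith [hρ i]
  rw [abs_of_pos (by positivity), coeffBound, div_pow]
  field_simp

/-- The weights `1 / ω̄` are bounded, since `√(2k + 1)` grows more slowly than `r^k`. -/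
lemma exists_inv_omegaBar_le {M : ℕ} {ρ : Fin M → ℝ} (hρ : ∀ i, 1 < ρ i) :
    ∃ B : ℝ, ∀ m, (omegaBar ρ m)⁻¹ ≤ B := by
  refine ⟨∏ i, (1 + 2 / (ρ i - 1)), fun m => ?_⟩
  rw [omegaBar_eq, ← Finset.prod_inv_distrib]
  refine Finset.prod_le_prod (fun i _ => ?_) fun i _ => ?_ <;>
    have h0 : 0 < ρ i := zero_lt_one.trans (hρ i)
  · positivity
  · have h1 : 0 < ρ i - 1 := sub_pos.2 (hρ i)
    have hbern : 1 + (m i : ℝ) * (ρ i - 1) ≤ ρ i ^ m i := by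
      simpa using one_add_mul_le_pow (a := ρ i - 1) (by linarith) (m i)
    have hsqrt : √(2 * (m i : ℝ) + 1) ≤ 2 * (m i : ℝ) + 1 :=
      Real.sqrt_le_self_iff.2 (Or.inr (by linarith [(m i).cast_nonneg (α := ℝ)]))
    rw [mul_inv, inv_inv, ← div_eq_mul_inv, div_le_iff₀ (by positivity)]
    have e : (1 + 2 / (ρ i - 1)) * (1 + (m i : ℝ) * (ρ i - 1)) =
        1 + (m i : ℝ) * (ρ i - 1) + 2 / (ρ i - 1) + 2 * m i := by field_simp; ring
    calc _ ≤ 2 * (m i : ℝ) + 1 := hsqrt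
      _ ≤ (1 + 2 / (ρ i - 1)) * (1 + (m i : ℝ) * (ρ i - 1)) := by
        rw [e]
        have : 0 ≤ (m i : ℝ) * (ρ i - 1) := by positivity
        have : 0 ≤ 2 / (ρ i - 1) := by positivity
        linarith
      _ ≤ _ := by gcongr

/-- Sums of product families over multi-indices factorize. -/
lemma ENNReal.tsum_prod_pi {M : ℕ} (f : Fin M → ℕ → ℝ≥0∞) :
    ∑' m : Fin M → ℕ, ∏ i, f i (m i) = ∏ i, ∑' k, f i k := by
  induction M with
  | zero => simp [tsum_fintype]
  | succ M ih =>
    rw [← (Fin.consEquiv fun _ : Fin (M + 1) => ℕ).tsum_eq, ENNReal.tsum_prod', Fin.prod_univ_succ,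
      ← ih fun i => f i.succ]
    simp only [Fin.consEquiv_apply, Fin.prod_univ_succ, Fin.cons_zero, Fin.cons_succ]
    simp_rw [ENNReal.tsum_mul_left, ENNReal.tsum_mul_right]

lemma ellNorm_prod_pow_lt_top {M : ℕ} {a : Fin M → ℝ≥0∞} (ha : ∀ i, a i < 1) {p : ℝ≥0∞}
    (hp : p ≠ 0) (hp' : p ≠ ∞) : ellNorm p (fun m => ∏ i, a i ^ m i) < ∞ := by
  have hp0 := ENNReal.toReal_pos hp hp'
  rw [ellNorm, eLpNorm_eq_lintegral_rpow_enorm_toReal hp hp', lintegral_count]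
  refine ENNReal.rpow_lt_top_of_nonneg (by positivity) (ne_of_lt ?_)
  have e : ∀ m : Fin M → ℕ, ‖∏ i, a i ^ m i‖ₑ ^ p.toReal = ∏ i, (a i ^ p.toReal) ^ m i :=
    fun m => by
      rw [enorm_eq_self, ← ENNReal.prod_rpow_of_nonneg hp0.le]
      simp_rw [← ENNReal.rpow_natCast, ← ENNReal.rpow_mul, mul_comm]
  simp_rw [e]
  rw [ENNReal.tsum_prod_pi fun i k => (a i ^ p.toReal) ^ k]
  refine ENNReal.prod_lt_top fun i _ => ?_
  rw [ENNReal.tsum_geometric, ENNReal.inv_lt_top]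
  exact tsub_pos_of_lt (ENNReal.rpow_lt_one (ha i) hp0)

lemma enorm_legendreCoeff_le {M : ℕ} {X : Type*} [NormedAddCommGroup X]
    [InnerProductSpace ℂ X] [CompleteSpace X] {ρ : Fin M → ℝ} (hρ : ∀ i, 1 < ρ i)
    {v : (Fin M → ℂ) → X} (hv : DifferentiableOn ℂ v (polydisc ρ))
    (hbdd : eLpNorm v ∞ (volume.restrict (polydisc ρ)) < ∞) (m : Fin M → ℕ) :
    ‖legendreCoeff v m‖ₑ ≤
      ENNReal.ofReal (bulletNorm fun i => ρ i ^ 2 / (ρ i ^ 2 - 1)) *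
        eLpNorm v ∞ (volume.restrict (polydisc ρ)) *
        (∏ i, ENNReal.ofReal (decayFactor (ρ i)) ^ m i) / ENNReal.ofReal (omegaBar ρ m) := by
  have hb : ∀ z ∈ polydisc ρ, ‖v z‖ ≤ (eLpNorm v ∞ (volume.restrict (polydisc ρ))).toReal :=
    fun z hz => by
      rw [← toReal_enorm]
      exact ENNReal.toReal_mono hbdd.ne
        (enorm_le_eLpNorm_top_restrict (isOpen_polydisc ρ) hv.continuousOn hz)
  have h := norm_legendreCoeff_le ρ hρ v hv hb m
  rw [prod_coeffBound hρ] at h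
  have hA : 0 ≤ bulletNorm fun i => ρ i ^ 2 / (ρ i ^ 2 - 1) :=
    Finset.prod_nonneg fun i _ => abs_nonneg _
  have hD : ∀ i, 0 ≤ decayFactor (ρ i) ^ m i := fun i => pow_nonneg (decayFactor_pos _).le _
  rw [← ofReal_norm]
  refine (ENNReal.ofReal_le_ofReal h).trans (le_of_eq ?_)
  rw [ENNReal.ofReal_mul ENNReal.toReal_nonneg, ENNReal.ofReal_toReal hbdd.ne,
    ENNReal.ofReal_div_of_pos (omegaBar_pos hρ m), ENNReal.ofReal_mul hA,
    ENNReal.ofReal_prod_of_nonneg fun i _ => hD i]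
  simp_rw [ENNReal.ofReal_pow (decayFactor_pos _).le]
  simp only [div_eq_mul_inv]
  ring

/-- As the coefficients decay faster than `1 / ω̄` by a factor lying in every `ℓ^p`, a weight only
has to be bounded by a multiple of `ω̄`. -/
lemma weightedEllNorm_legendreCoeff_lt_top {M : ℕ} {X : Type*} [NormedAddCommGroup X]
    [InnerProductSpace ℂ X] [CompleteSpace X] {ρ : Fin M → ℝ} (hρ : ∀ i, 1 < ρ i)
    {v : (Fin M → ℂ) → X} (hv : DifferentiableOn ℂ v (polydisc ρ))
    (hbdd : eLpNorm v ∞ (volume.restrict (polydisc ρ)) < ∞) {p : ℝ≥0∞} (hp : p ≠ 0) (hp' : p ≠ ∞)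
    {w : (Fin M → ℕ) → ℝ≥0∞} {B : ℝ≥0∞} (hB : B < ∞)
    (hw : ∀ m, w m / ENNReal.ofReal (omegaBar ρ m) ≤ B) :
    weightedEllNorm p w (legendreCoeff v) < ∞ := by
  set A := ENNReal.ofReal (bulletNorm fun i => ρ i ^ 2 / (ρ i ^ 2 - 1)) *
    eLpNorm v ∞ (volume.restrict (polydisc ρ)) with hA
  have hAB : A * B ≠ ∞ := (ENNReal.mul_lt_top (ENNReal.mul_lt_top ENNReal.ofReal_lt_top hbdd) hB).ne
  have hle : weightedEllNorm p w (legendreCoeff v) ≤ ((A * B).toNNReal : ℝ≥0∞) *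
      ellNorm p (fun m => ∏ i, ENNReal.ofReal (decayFactor (ρ i)) ^ m i) := by
    refine eLpNorm_le_mul_eLpNorm_of_ae_le_mul' (ae_of_all _ fun m => ?_) p
    rw [enorm_eq_self, enorm_eq_self, ENNReal.coe_toNNReal hAB]
    calc _ ≤ w m * (A * (∏ i, ENNReal.ofReal (decayFactor (ρ i)) ^ m i) /
          ENNReal.ofReal (omegaBar ρ m)) := by
          gcongr; exact enorm_legendreCoeff_le hρ hv hbdd m
      _ = A * (w m / ENNReal.ofReal (omegaBar ρ m)) *
          ∏ i, ENNReal.ofReal (decayFactor (ρ i)) ^ m i := by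
          simp only [div_eq_mul_inv]; ring
      _ ≤ _ := by gcongr; exact hw m
  exact hle.trans_lt (ENNReal.mul_lt_top ENNReal.coe_lt_top (ellNorm_prod_pow_lt_top
    (fun i => ENNReal.ofReal_lt_one.2 (decayFactor_lt_one (hρ i))) hp hp'))

theorem mainTheorem7 {M : ℕ} {X : Type*} [NormedAddCommGroup X] [InnerProductSpace ℂ X]
    [CompleteSpace X] (ρ : Fin M → ℝ) (hρ : ∀ i, 1 < ρ i)
    (v : (Fin M → ℂ) → X) (hv : DifferentiableOn ℂ v (polydisc ρ))
    (hbdd : eLpNorm v ∞ (volume.restrict (polydisc ρ)) < ∞) :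
    (∀ (p : ℝ≥0∞), 0 < p → ∀ (ω' : (Fin M → ℕ) → ℝ), (∀ m, 0 < ω' m) →
      weightedEllNorm p (fun m => ENNReal.ofReal (ω' m)) (legendreCoeff v) ≤
        ENNReal.ofReal (bulletNorm fun i => ρ i ^ 2 / (ρ i ^ 2 - 1)) *
          ellNorm p (fun m => ENNReal.ofReal (ω' m / omegaBar ρ m)) *
          eLpNorm v ∞ (volume.restrict (polydisc ρ))) ∧
    weightedEllNorm 2 (fun _ => 1) (legendreCoeff v) < ∞ ∧
    (∀ (p : ℝ), 0 < p → ∀ (ω : (Fin M → ℕ) → ℝ≥0∞),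
      (ellNorm (ENNReal.ofReal p)
          (fun m => ω m ^ ((2 - p) / p) / ENNReal.ofReal (omegaBar ρ m)) < ∞ ∨
        ellNorm 1 (fun m => ω m ^ ((2 - p) / p) / ENNReal.ofReal (omegaBar ρ m)) < ∞) →
      weightedEllNorm (ENNReal.ofReal p) (fun m => ω m ^ ((2 - p) / p)) (legendreCoeff v) < ∞) := by
  refine ⟨fun p _ ω' _ => ?_, ?_, fun p hp ω hω => ?_⟩
  · set A := ENNReal.ofReal (bulletNorm fun i => ρ i ^ 2 / (ρ i ^ 2 - 1)) *
      eLpNorm v ∞ (volume.restrict (polydisc ρ)) with hA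
    have hA' : A ≠ ∞ := (ENNReal.mul_lt_top ENNReal.ofReal_lt_top hbdd).ne
    rw [mul_right_comm, ← hA, ← ENNReal.coe_toNNReal hA']
    refine eLpNorm_le_mul_eLpNorm_of_ae_le_mul' (ae_of_all _ fun m => ?_) p
    rw [enorm_eq_self, enorm_eq_self, ENNReal.coe_toNNReal hA',
      ENNReal.ofReal_div_of_pos (omegaBar_pos hρ m)]
    have hD : ∏ i, ENNReal.ofReal (decayFactor (ρ i)) ^ m i ≤ 1 :=
      Finset.prod_le_one' fun i _ => pow_le_one' (ENNReal.ofReal_le_one.2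
        (decayFactor_lt_one (hρ i)).le) _
    calc _ ≤ ENNReal.ofReal (ω' m) * (A * 1 / ENNReal.ofReal (omegaBar ρ m)) := by
          gcongr
          refine (enorm_legendreCoeff_le hρ hv hbdd m).trans ?_
          gcongr
      _ = _ := by simp only [div_eq_mul_inv]; ring
  · obtain ⟨B, hB⟩ := exists_inv_omegaBar_le hρ
    refine weightedEllNorm_legendreCoeff_lt_top hρ hv hbdd two_ne_zero ENNReal.ofNat_ne_top
      (B := ENNReal.ofReal B) ENNReal.ofReal_lt_top fun m => ?_
    rw [one_div, ← ENNReal.ofReal_inv_of_pos (omegaBar_pos hρ m)]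
    exact ENNReal.ofReal_le_ofReal (hB m)
  · have hp' : ENNReal.ofReal p ≠ 0 := (ENNReal.ofReal_pos.2 hp).ne'
    -- either summability hypothesis is used only through the supremum bound it implies
    rcases hω with h | h <;>
      refine weightedEllNorm_legendreCoeff_lt_top hρ hv hbdd hp' ENNReal.ofReal_ne_top h fun m => ?_
    · exact enorm_le_eLpNorm_count (fun m => ω m ^ ((2 - p) / p) / ENNReal.ofReal (omegaBar ρ m))
        m hp'
    · exact enorm_le_eLpNorm_count (fun m => ω m ^ ((2 - p) / p) / ENNReal.ofReal (omegaBar ρ m))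
        m one_ne_zero
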